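/- Let $p,d,n,K\ge 1$ be integers and let $\|\cdot\|$ be the Euclidean norm. Let $\mathcal X\subseteq\mathbb R^p$ be compact with $\max_{x\in\mathcal X}\|x\|_\infty=\bar X>0$, let $(X,Y)$ be a random pair with values in $\mathcal X\times\mathcal Y$, and let $S=\{(x^s,y^s)\}_{s=1}^n$ be i.i.d. copies of $(X,Y)$. Let $\varphi:\mathbb R^d\times\mathcal Y\to\mathbb R$ be a cost function, measurable in its second argument, such that for some $L_\varphi,C_\varphi>0$ and $z_0\in\mathbb R^d$ and all $y\in\mathcal Y$, the function $\varphi(\cdot;y)$ is $L_\varphi$-Lipschitz on $\mathbb R^d$ and $|\varphi(z_0;y)|\le C_\varphi$. For $f:\mathcal X\to\mathbb R^d$ put $$R(f)=\mathbb E[\varphi(f(X);Y)],\qquad \widehat R_S(f)=\frac1n\sum_{s=1}^n\varphi(f(x^s);y^s),$$ where the expectation is extended-real valued and equals $+\infty$ if the positive part is not integrable, and let $\mathcal F$ be the set of all measurable functions $\mathcal X\to\mathbb R^d$. Suppose that some $f^*\in\mathcal F$ minimizes $R$ over $\mathcal F$ and that, for some $L_z,M_z>0$, $f^*$ is $L_z$-Lipschitz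 and $|f^*_\iota(x)|\le M_z$ for all $x\in\mathcal X$ and $\iota\in\{1,\dots,d\}$. Let $\mathcal H^K_\mu$ be the class of piecewise affine decision rules (PADR), that is, of the functions $f=(f_\iota)_{\iota=1}^d:\mathcal X\to\mathbb R^d$ with $$f_\iota(x)=\max_{1\le k\le K}\{(\alpha^k_\iota)^\top x+a^k_\iota\}-\max_{1\le k\le K}\{(\beta^k_\iota)^\top x+b^k_\iota\},$$ where all entries of $\alpha^k_\iota,\beta^k_\iota\in\mathbb R^p$ and $a^k_\iota,b^k_\iota\in\mathbb R$ have absolute value at most $\mu$. Assume $$\mu\ge\max\left\{\tfrac12L_zK^{1/p},\ \tfrac14pL_z\bar XK^{1/p}+\tfrac12M_z\right\},\qquad M_\mu:=C_\varphi+L_\varphi\left(2\sqrt d\,\mu(p\bar X+1)+\|z_0\|\right),$$ and let $\delta>0$. Then $\widehat R_S$ has a minimizer over $\mathcal H^K_\mu$, and with probability at least $1-\delta$ over the draw of $S$, every minimizer $f^*_S$ of $\widehat R_S$ over $\mathcal H^K_\mu$ satisfies $$\begin{aligned}R(f^*_S)\le{}&\inf_{f\in\mathcal F}R(f)+2d^{1/2}(p^{1/2}+3)p^{1/2}L_\varphi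 L_z\bar XK^{-1/p}+\frac{16\mu L_\varphi\sqrt{2dK(p+1)(p\bar X^2+1)}}{n}\\&+4M_\mu\sqrt{\frac{2dK(p+1)\log n}{n}}+2\sqrt2\,M_\mu\sqrt{\frac{\log(2/\delta)}{n}}.\end{aligned}$$ -/

import Mathlib

open MeasureTheory ProbabilityTheory

/-- The parameter `(α^k, a^k, β^k, b^k)_{k = 1, …, K}` in `ℝ^(2 K (p + 1))` of a difference of two
max-affine functions on `ℝ^p` with `K` pieces each. Mathlib's norm on this product type is the
maximum of the absolute values of all entries, i.e. the sup-norm. -/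
abbrev PAParam (p K : ℕ) : Type :=
  (Fin K → Fin p → ℝ) × (Fin K → ℝ) × (Fin K → Fin p → ℝ) × (Fin K → ℝ)

/-- `max_k (⟨α^k, x⟩ + a^k)`, the maximum being over `k` in `Fin K` (used with `K ≥ 1`). -/
noncomputable def maxAffine {p K : ℕ} (α : Fin K → Fin p → ℝ) (a : Fin K → ℝ)
    (x : EuclideanSpace ℝ (Fin p)) : ℝ :=
  ⨆ k : Fin K, ((∑ j : Fin p, α k j * x j) + a k)

/-- The piecewise affine function `max_k (⟨α^k, x⟩ + a^k) - max_k (⟨β^k, x⟩ + b^k)`. -/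
noncomputable def paFun {p K : ℕ} (θ : PAParam p K) (x : EuclideanSpace ℝ (Fin p)) : ℝ :=
  maxAffine θ.1 θ.2.1 x - maxAffine θ.2.2.1 θ.2.2.2 x

/-- The class of piecewise affine decision rules `𝒳 → ℝ^d`: every component is a difference of two
max-affine functions with `K` pieces whose parameter has sup-norm at most `μ`. -/
def padrClass {p : ℕ} (𝒳 : Set (EuclideanSpace ℝ (Fin p))) (d K : ℕ) (μ : ℝ) :
    Set (𝒳 → EuclideanSpace ℝ (Fin d)) :=
  {f | ∃ θ : Fin d → PAParam p K, (∀ i, ‖θ i‖ ≤ μ) ∧ ∀ (x : 𝒳) (i : Fin d), f x i = paFun (θ i) x}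

/-- The functions `𝒳 → ℝ^d` that are `L`-Lipschitz for the Euclidean norms and all of whose
components are bounded by `M` in absolute value. -/
def lipClass {p : ℕ} (𝒳 : Set (EuclideanSpace ℝ (Fin p))) (d : ℕ) (L M : ℝ) :
    Set (𝒳 → EuclideanSpace ℝ (Fin d)) :=
  {f | (∀ (x : 𝒳) (i : Fin d), |f x i| ≤ M) ∧
    ∀ x x' : 𝒳, ‖f x - f x'‖ ≤ L * ‖(x : EuclideanSpace ℝ (Fin p)) - x'‖}

open Classical in
/-- The extended-real expectation `E[g⁺] - E[g⁻]`, with value `+∞` whenever `E[g⁺] = +∞` (the usual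
convention for minimization). For an integrable `g` it is the ordinary expectation. -/
noncomputable def extExpectation {Ω : Type*} [MeasurableSpace Ω] (P : Measure Ω) (g : Ω → ℝ) :
    EReal :=
  if ∫⁻ ω, ENNReal.ofReal (g ω) ∂P = ⊤ then ⊤
  else ((∫⁻ ω, ENNReal.ofReal (g ω) ∂P : ENNReal) : EReal)
    - ((∫⁻ ω, ENNReal.ofReal (-g ω) ∂P : ENNReal) : EReal)

/-- The risk `R(f) = E[φ(f(X); Y)]` of a decision rule `f`, where `(X, Y)` has law `P`. -/
noncomputable def risk {𝒳 𝒴 Z : Type*} [MeasurableSpace 𝒳] [MeasurableSpace 𝒴]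
    (P : Measure (𝒳 × 𝒴)) (φ : Z → 𝒴 → ℝ) (f : 𝒳 → Z) : EReal :=
  extExpectation P fun q => φ (f q.1) q.2

/-- The empirical risk `(1/n) ∑_s φ(f(x^s); y^s)` of a decision rule `f`. -/
noncomputable def empRisk {𝒳 𝒴 Z : Type*} {n : ℕ} (φ : Z → 𝒴 → ℝ) (S : Fin n → 𝒳 × 𝒴)
    (f : 𝒳 → Z) : ℝ :=
  (1 / (n : ℝ)) * ∑ s : Fin n, φ (f (S s).1) (S s).2

/-- The set of solutions of the empirical risk minimization problem over a class `H`. -/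
def ermSolutions {𝒳 𝒴 Z : Type*} {n : ℕ} (φ : Z → 𝒴 → ℝ) (S : Fin n → 𝒳 × 𝒴)
    (H : Set (𝒳 → Z)) : Set (𝒳 → Z) :=
  {f | f ∈ H ∧ ∀ g ∈ H, empRisk φ S f ≤ empRisk φ S g}

/-! The excess risk splits into an approximation error and an estimation error.

Approximation (`exists_paFun_approx`): write `g = (λ‖x‖² + g/2) - (λ‖x‖² - g/2)`. For each center
`c`, the function `λ‖x‖² + h c - λ‖x - c‖²` is affine in `x`. With `h = ±g/2`, maximizing over the
points `c` of a net nearly recovers each bracket. A cube in dimension `p` has a `K`-point net of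
mesh of order `K^(-1/p)`, which gives the rate.

Estimation (`exists_event_deviation`): rules depend Lipschitz-continuously on their parameters, so a
net of mesh `μ/n` with `n^(2dK(p+1))` points replaces the class at cost `O(1/n)`. Hoeffding's
inequality and a union bound control the net. Only upper bounds on the risk are needed there. The
comparison rule `θ₀` does not depend on the sample, so one opposite deviation bound suffices for it.
-/

/-! ### Finite nets of sup-norm balls. -/

/-- The ball of radius `r` about `0` in `E` has an `ε`-net with at most `N` points, all of which lie
in that ball. -/
def HasFiniteNet (E : Type*) [SeminormedAddCommGroup E] (r ε : ℝ) (N : ℕ) : Prop :=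
  ∃ s : Finset E, s.card ≤ N ∧ (∀ y ∈ s, ‖y‖ ≤ r) ∧ ∀ x : E, ‖x‖ ≤ r → ∃ y ∈ s, ‖x - y‖ ≤ ε

theorem hasFiniteNet_real {n : ℕ} (hn : 1 ≤ n) {r : ℝ} (hr : 0 ≤ r) :
    HasFiniteNet ℝ r (r / n) n := by
  classical
  have hn0 : (0 : ℝ) < n := by exact_mod_cast hn
  refine ⟨(Finset.range n).image fun i : ℕ => -r + (2 * i + 1) * (r / n),
    Finset.card_image_le.trans_eq (Finset.card_range n), ?_, ?_⟩
  · intro y hy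
    obtain ⟨i, hi, rfl⟩ := Finset.mem_image.1 hy
    have hi' : (i : ℝ) + 1 ≤ n := by exact_mod_cast Finset.mem_range.1 hi
    have h1 : 0 ≤ (2 * (i : ℝ) + 1) * (r / n) := by positivity
    have h2 : (2 * (i : ℝ) + 1) * (r / n) ≤ (2 * n) * (r / n) := by gcongr; linarith
    have h3 : 2 * (n : ℝ) * (r / n) = 2 * r := by field_simp
    rw [Real.norm_eq_abs, abs_le]
    constructor <;> linarith
  · intro x hx
    rw [Real.norm_eq_abs, abs_le] at hx
    rcases hr.eq_or_lt with rfl | hr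
    · refine ⟨_, Finset.mem_image_of_mem _ (Finset.mem_range.2 hn), ?_⟩
      have : x = 0 := by linarith
      simp [this]
    set u : ℝ := (x + r) * n / (2 * r) with hu
    have hu0 : 0 ≤ u := by
      have : 0 ≤ x + r := by linarith
      positivity
    have hun : u ≤ n := by
      rw [hu, div_le_iff₀ (by positivity)]
      nlinarith
    have hx' : x = -r + 2 * u * (r / n) := by rw [hu]; field_simp; ring
    have hrn : 0 < r / n := by positivity
    -- The net consists of the midpoints of `n` equal cells; `u` is the position of `x` in cell
    -- units. The endpoint `u = n` is assigned to the last cell.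
    obtain ⟨i, hi, h1, h2⟩ : ∃ i : ℕ, i < n ∧ (i : ℝ) ≤ u ∧ u ≤ i + 1 := by
      by_cases h : ⌊u⌋₊ < n
      · exact ⟨_, h, Nat.floor_le hu0, (Nat.lt_floor_add_one u).le⟩
      · have h' : (n : ℝ) ≤ u := (Nat.le_floor_iff hu0).1 (not_lt.1 h)
        refine ⟨n - 1, by omega, ?_, ?_⟩ <;> push_cast [Nat.cast_sub hn] <;> linarith
    refine ⟨_, Finset.mem_image_of_mem _ (Finset.mem_range.2 hi), ?_⟩
    have : x - (-r + (2 * i + 1) * (r / n)) = (2 * (u - i) - 1) * (r / n) := by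
      rw [hx']; ring
    rw [this, norm_mul, Real.norm_of_nonneg hrn.le]
    refine mul_le_of_le_one_left hrn.le ?_
    rw [Real.norm_eq_abs, abs_le]
    constructor <;> linarith

theorem HasFiniteNet.prod {E F : Type*} [SeminormedAddCommGroup E] [SeminormedAddCommGroup F]
    {r ε : ℝ} {N M : ℕ} (hE : HasFiniteNet E r ε N) (hF : HasFiniteNet F r ε M) :
    HasFiniteNet (E × F) r ε (N * M) := by
  obtain ⟨s, hs, hsr, hsε⟩ := hE
  obtain ⟨t, ht, htr, htε⟩ := hF
  refine ⟨s ×ˢ t, ?_, ?_, ?_⟩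
  · rw [Finset.card_product]
    gcongr
  · rintro ⟨y, z⟩ hyz
    rw [Finset.mem_product] at hyz
    exact norm_prod_le_iff.2 ⟨hsr _ hyz.1, htr _ hyz.2⟩
  · rintro ⟨x, w⟩ hxw
    rw [norm_prod_le_iff] at hxw
    obtain ⟨y, hy, hxy⟩ := hsε x hxw.1
    obtain ⟨z, hz, hwz⟩ := htε w hxw.2
    exact ⟨(y, z), Finset.mk_mem_product hy hz, norm_prod_le_iff.2 ⟨hxy, hwz⟩⟩

theorem HasFiniteNet.pi {E : Type*} [SeminormedAddCommGroup E] {r ε : ℝ} {N : ℕ}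
    (hE : HasFiniteNet E r ε N) (hr : 0 ≤ r) (hε : 0 ≤ ε) (k : ℕ) :
    HasFiniteNet (Fin k → E) r ε (N ^ k) := by
  classical
  obtain ⟨s, hs, hsr, hsε⟩ := hE
  refine ⟨Fintype.piFinset fun _ => s, ?_, ?_, ?_⟩
  · rw [Fintype.card_piFinset_const]
    exact Nat.pow_le_pow_left hs k
  · intro y hy
    rw [Fintype.mem_piFinset] at hy
    exact (pi_norm_le_iff_of_nonneg hr).2 fun i => hsr _ (hy i)
  · intro x hx
    rw [pi_norm_le_iff_of_nonneg hr] at hx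
    choose y hy hxy using fun i => hsε (x i) (hx i)
    exact ⟨y, Fintype.mem_piFinset.2 hy, (pi_norm_le_iff_of_nonneg hε).2 hxy⟩

/-- The norm is a maximum over `2dK(p+1)` real entries, so one-dimensional nets multiply. Keeping
the net inside the ball lets its rules inherit the loss bound that Hoeffding's inequality needs. -/
theorem hasFiniteNet_paParam {n : ℕ} (hn : 1 ≤ n) {r : ℝ} (hr : 0 ≤ r) (d p K : ℕ) :
    HasFiniteNet (Fin d → PAParam p K) r (r / n) (n ^ (2 * d * K * (p + 1))) := by
  have hε : 0 ≤ r / n := by positivity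
  have h0 := hasFiniteNet_real hn hr
  have hα := (h0.pi hr hε p).pi hr hε K
  have ha := h0.pi hr hε K
  have h := (hα.prod (ha.prod (hα.prod ha))).pi hr hε d
  have hN : n ^ (2 * d * K * (p + 1)) = ((n ^ p) ^ K * (n ^ K * ((n ^ p) ^ K * n ^ K))) ^ d := by
    ring
  rwa [hN]

/-! ### Max-affine functions: parameter dependence and paraboloid approximation. -/

section maxAffine

variable {p K : ℕ}

theorem le_maxAffine (α : Fin K → Fin p → ℝ) (a : Fin K → ℝ) (x : EuclideanSpace ℝ (Fin p))
    (k : Fin K) : (∑ j, α k j * x j) + a k ≤ maxAffine α a x :=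
  le_ciSup (f := fun k => (∑ j, α k j * x j) + a k) (Set.finite_range _).bddAbove k

theorem maxAffine_le (hK : 1 ≤ K) {α : Fin K → Fin p → ℝ} {a : Fin K → ℝ}
    {x : EuclideanSpace ℝ (Fin p)} {c : ℝ} (h : ∀ k, (∑ j, α k j * x j) + a k ≤ c) :
    maxAffine α a x ≤ c :=
  have : Nonempty (Fin K) := ⟨⟨0, hK⟩⟩
  ciSup_le h

theorem continuous_maxAffine (hK : 1 ≤ K) :
    Continuous fun q : (Fin K → Fin p → ℝ) × (Fin K → ℝ) × EuclideanSpace ℝ (Fin p) =>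
      maxAffine q.1 q.2.1 q.2.2 := by
  have : Nonempty (Fin K) := ⟨⟨0, hK⟩⟩
  simp only [maxAffine, ← Finset.sup'_univ_eq_ciSup]
  refine Continuous.finset_sup'_apply _ fun k _ => ?_
  fun_prop

/-- Continuity in the parameter yields empirical minimizers; continuity in `x` yields measurable
losses. -/
theorem continuous_paFun (hK : 1 ≤ K) :
    Continuous fun q : PAParam p K × EuclideanSpace ℝ (Fin p) => paFun q.1 q.2 := by
  unfold paFun
  refine Continuous.sub ?_ ?_
  · exact (continuous_maxAffine hK).comp
      (g := fun q : (Fin K → Fin p → ℝ) × (Fin K → ℝ) × EuclideanSpace ℝ (Fin p) =>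
        maxAffine q.1 q.2.1 q.2.2)
      (f := fun q : PAParam p K × EuclideanSpace ℝ (Fin p) => (q.1.1, q.1.2.1, q.2)) (by fun_prop)
  · exact (continuous_maxAffine hK).comp
      (g := fun q : (Fin K → Fin p → ℝ) × (Fin K → ℝ) × EuclideanSpace ℝ (Fin p) =>
        maxAffine q.1 q.2.1 q.2.2)
      (f := fun q : PAParam p K × EuclideanSpace ℝ (Fin p) => (q.1.2.2.1, q.1.2.2.2, q.2))
      (by fun_prop)

/-- Each affine piece moves by at most `p * X * r + r`, and a maximum moves no more than its pieces.
-/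
theorem maxAffine_sub_le (hK : 1 ≤ K) {α α' : Fin K → Fin p → ℝ} {a a' : Fin K → ℝ} {r X : ℝ}
    (hα : ‖α - α'‖ ≤ r) (ha : ‖a - a'‖ ≤ r) {x : EuclideanSpace ℝ (Fin p)}
    (hx : ∀ j, |x j| ≤ X) :
    maxAffine α a x - maxAffine α' a' x ≤ (p * X + 1) * r := by
  have hr : 0 ≤ r := (norm_nonneg _).trans hα
  rw [sub_le_iff_le_add]
  refine maxAffine_le hK fun k => ?_
  have h1 := le_maxAffine α' a' x k
  have h2 : a k - a' k ≤ r :=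
    (le_abs_self _).trans ((norm_le_pi_norm (a - a') k).trans ha)
  have h3 : ∑ j, (α k j - α' k j) * x j ≤ ∑ _j : Fin p, r * X := by
    refine Finset.sum_le_sum fun j _ => ?_
    have h4 : |α k j - α' k j| ≤ r :=
      (norm_le_pi_norm ((α - α') k) j).trans ((norm_le_pi_norm (α - α') k).trans hα)
    refine (le_abs_self _).trans ?_
    rw [abs_mul]
    exact mul_le_mul h4 (hx j) (abs_nonneg _) hr
  simp only [sub_mul, Finset.sum_sub_distrib, Finset.sum_const, Finset.card_univ,
    Fintype.card_fin, nsmul_eq_mul] at h3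
  linarith

theorem abs_paFun_sub_le (hK : 1 ≤ K) {θ θ' : PAParam p K} {r X : ℝ} (hθ : ‖θ - θ'‖ ≤ r)
    {x : EuclideanSpace ℝ (Fin p)} (hx : ∀ j, |x j| ≤ X) :
    |paFun θ x - paFun θ' x| ≤ 2 * (p * X + 1) * r := by
  have key : ∀ {θ θ' : PAParam p K}, ‖θ - θ'‖ ≤ r →
      paFun θ x - paFun θ' x ≤ 2 * (p * X + 1) * r := by
    intro θ θ' h
    simp only [norm_prod_le_iff] at h
    obtain ⟨h1, h2, h3, h4⟩ := h
    have hA := maxAffine_sub_le hK h1 h2 hx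
    have hB := maxAffine_sub_le hK ((norm_sub_rev _ _).trans_le h3)
      ((norm_sub_rev _ _).trans_le h4) hx
    unfold paFun
    linarith
  rw [abs_sub_le_iff]
  exact ⟨key hθ, key ((norm_sub_rev _ _).trans_le hθ)⟩

theorem abs_paFun_le (hK : 1 ≤ K) {θ : PAParam p K} {r X : ℝ} (hθ : ‖θ‖ ≤ r)
    {x : EuclideanSpace ℝ (Fin p)} (hx : ∀ j, |x j| ≤ X) :
    |paFun θ x| ≤ 2 * (p * X + 1) * r := by
  have h := abs_paFun_sub_le hK (θ := θ) (θ' := 0) (by simpa using hθ) hx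
  simpa [paFun] using h

/-- The maximum over `k` of the minorants `λ ‖x‖² + h (c k) - λ ‖x - c k‖²`, which are affine in
`x`, approximates `λ ‖x‖² + h x`. -/
theorem maxAffine_paraboloid (hK : 1 ≤ K) {h : EuclideanSpace ℝ (Fin p) → ℝ} {L lam D : ℝ}
    (hL : 0 ≤ L) (hlam : 0 < lam) (hh : ∀ x y, |h x - h y| ≤ L * ‖x - y‖)
    (c : Fin K → EuclideanSpace ℝ (Fin p)) {x : EuclideanSpace ℝ (Fin p)}
    (hx : ∃ k, ‖x - c k‖ ≤ D) :
    lam * ‖x‖ ^ 2 + h x - (L * D + lam * D ^ 2) ≤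
        maxAffine (fun k j => 2 * lam * c k j) (fun k => -(lam * ‖c k‖ ^ 2) + h (c k)) x ∧
      maxAffine (fun k j => 2 * lam * c k j) (fun k => -(lam * ‖c k‖ ^ 2) + h (c k)) x ≤
        lam * ‖x‖ ^ 2 + h x + L ^ 2 / (4 * lam) := by
  have affine_eq : ∀ k, (∑ j, 2 * lam * c k j * x j) + (-(lam * ‖c k‖ ^ 2) + h (c k)) =
      lam * ‖x‖ ^ 2 + h (c k) - lam * ‖x - c k‖ ^ 2 := by
    intro k
    have : ∑ j, 2 * lam * c k j * x j = lam * ‖x‖ ^ 2 + lam * ‖c k‖ ^ 2 - lam * ‖x - c k‖ ^ 2 := by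
      simp only [EuclideanSpace.real_norm_sq_eq, Finset.mul_sum, ← Finset.sum_add_distrib,
        ← Finset.sum_sub_distrib, PiLp.sub_apply]
      exact Finset.sum_congr rfl fun j _ => by ring
    rw [this]; ring
  constructor
  · obtain ⟨k, hk⟩ := hx
    refine le_trans ?_ (le_maxAffine _ _ x k)
    rw [affine_eq]
    have h1 := (abs_le.1 (hh x (c k))).2
    have h2 : L * ‖x - c k‖ ≤ L * D := by gcongr
    have h3 : lam * ‖x - c k‖ ^ 2 ≤ lam * D ^ 2 := by gcongr
    linarith
  · refine maxAffine_le hK fun k => ?_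
    rw [affine_eq]
    have h1 := (abs_le.1 (hh x (c k))).1
    -- The maximum of `L t - lam t²` is attained at `t = L / (2 lam)`.
    have h2 : L * ‖x - c k‖ - lam * ‖x - c k‖ ^ 2 ≤ L ^ 2 / (4 * lam) := by
      rw [le_div_iff₀ (by positivity)]
      nlinarith [sq_nonneg (L - 2 * lam * ‖x - c k‖)]
    linarith

/-- A bounded Lipschitz function is approximated by a piecewise affine function built from
paraboloids centered at the points of a `D`-net. -/
theorem exists_paFun_approx_of_net (hK : 1 ≤ K) {g : EuclideanSpace ℝ (Fin p) → ℝ}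
    {L M lam D X μ : ℝ} (hL : 0 ≤ L) (hlam : 0 < lam) (hX : 0 ≤ X)
    (hg : ∀ x y, |g x - g y| ≤ L * ‖x - y‖) (hgM : ∀ x, |g x| ≤ M)
    (c : Fin K → EuclideanSpace ℝ (Fin p)) (hc : ∀ k j, |c k j| ≤ X)
    (hμ1 : 2 * lam * X ≤ μ) (hμ2 : lam * (p * X ^ 2) + M / 2 ≤ μ) :
    ∃ θ : PAParam p K, ‖θ‖ ≤ μ ∧ ∀ x, (∃ k, ‖x - c k‖ ≤ D) →
      |paFun θ x - g x| ≤ L / 2 * D + lam * D ^ 2 + (L / 2) ^ 2 / (4 * lam) := by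
  have hμ : 0 ≤ μ := le_trans (by positivity) hμ1
  have hα : ‖fun (k : Fin K) (j : Fin p) => 2 * lam * c k j‖ ≤ μ := by
    refine (pi_norm_le_iff_of_nonneg hμ).2 fun k => (pi_norm_le_iff_of_nonneg hμ).2 fun j => ?_
    rw [Real.norm_eq_abs, abs_mul, abs_of_pos (by positivity)]
    exact le_trans (by gcongr; exact hc k j) hμ1
  have hnorm : ∀ k, lam * ‖c k‖ ^ 2 ≤ lam * (p * X ^ 2) := by
    intro k
    gcongr
    rw [EuclideanSpace.real_norm_sq_eq]
    calc ∑ j, c k j ^ 2 ≤ ∑ _j : Fin p, X ^ 2 :=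
          Finset.sum_le_sum fun j _ => sq_le_sq' (abs_le.1 (hc k j)).1 (abs_le.1 (hc k j)).2
      _ = p * X ^ 2 := by simp
  have ha : ∀ h : EuclideanSpace ℝ (Fin p) → ℝ, (∀ x, |h x| ≤ M / 2) →
      ‖fun k : Fin K => -(lam * ‖c k‖ ^ 2) + h (c k)‖ ≤ μ := by
    intro h hh
    refine (pi_norm_le_iff_of_nonneg hμ).2 fun k => ?_
    have h1 : 0 ≤ lam * ‖c k‖ ^ 2 := by positivity
    have h2 := abs_le.1 (hh (c k))
    have h3 := hnorm k
    rw [Real.norm_eq_abs, abs_le]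
    constructor <;> linarith
  have lip : ∀ x y, |g x / 2 - g y / 2| ≤ L / 2 * ‖x - y‖ := by
    intro x y
    rw [← sub_div, abs_div, abs_two]
    linarith [hg x y]
  have lip' : ∀ x y, |-(g x / 2) - -(g y / 2)| ≤ L / 2 * ‖x - y‖ := by
    intro x y
    rw [neg_sub_neg, abs_sub_comm]
    exact lip x y
  -- Splitting `g` into halves gives both brackets Lipschitz constant `L / 2` and offset at most `M
  -- / 2`. The error is the overshoot of one maximum plus the undershoot of the other.
  refine ⟨(fun k j => 2 * lam * c k j, fun k => -(lam * ‖c k‖ ^ 2) + g (c k) / 2,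
    fun k j => 2 * lam * c k j, fun k => -(lam * ‖c k‖ ^ 2) + -(g (c k) / 2)), ?_, ?_⟩
  · refine norm_prod_le_iff.2 ⟨hα, norm_prod_le_iff.2 ⟨?_, norm_prod_le_iff.2 ⟨hα, ?_⟩⟩⟩
    · refine ha (fun x => g x / 2) fun x => ?_
      rw [abs_div, abs_two]
      linarith [hgM x]
    · refine ha (fun x => -(g x / 2)) fun x => ?_
      rw [abs_neg, abs_div, abs_two]
      linarith [hgM x]
  · intro x hx
    have h1 := maxAffine_paraboloid hK (div_nonneg hL zero_le_two) hlam lip c hx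
    have h2 := maxAffine_paraboloid hK (div_nonneg hL zero_le_two) hlam lip' c hx
    simp only [paFun]
    rw [abs_le]
    constructor <;> linarith [h1.1, h1.2, h2.1, h2.2]

end maxAffine

/-! ### Approximation of bounded Lipschitz functions at rate `K^(-1/p)`. -/

/-- Surplus indices repeat a point: a max-affine function has exactly `K` pieces, and repeating one
changes nothing. -/
theorem Finset.exists_fin_enumeration {E : Type*} {s : Finset E} (hs : s.Nonempty) {K : ℕ}
    (hK : s.card ≤ K) : ∃ c : Fin K → E, (∀ k, c k ∈ s) ∧ ∀ y ∈ s, ∃ k, c k = y := by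
  obtain ⟨y₀, hy₀⟩ := hs
  refine ⟨fun k => if h : (k : ℕ) < s.card then (s.equivFin.symm ⟨k, h⟩ : E) else y₀,
    fun k => ?_, fun y hy => ?_⟩
  · dsimp only
    split_ifs
    · exact Subtype.prop _
    · exact hy₀
  · refine ⟨⟨s.equivFin ⟨y, hy⟩, (s.equivFin ⟨y, hy⟩).2.trans_le hK⟩, ?_⟩
    simp

theorem EuclideanSpace.norm_le_sqrt_card_mul {p : ℕ} {v : EuclideanSpace ℝ (Fin p)} {ε : ℝ}
    (hε : 0 ≤ ε) (hv : ∀ j, |v j| ≤ ε) : ‖v‖ ≤ √p * ε := by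
  refine le_of_sq_le_sq ?_ (by positivity)
  rw [mul_pow, Real.sq_sqrt (Nat.cast_nonneg p), EuclideanSpace.real_norm_sq_eq]
  calc ∑ j, v j ^ 2 ≤ ∑ _j : Fin p, ε ^ 2 :=
        Finset.sum_le_sum fun j _ => sq_le_sq' (abs_le.1 (hv j)).1 (abs_le.1 (hv j)).2
    _ = p * ε ^ 2 := by simp

/-- A bounded Lipschitz function on a set extends to the whole space with the same bound and the
same Lipschitz constant. -/
theorem exists_lipschitz_extension {E : Type*} [SeminormedAddCommGroup E] {s : Set E}
    {f : s → ℝ} {L M : ℝ} (hL : 0 ≤ L) (hM : 0 ≤ M) (hf : ∀ x y : s, |f x - f y| ≤ L * ‖(x : E) - y‖)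
    (hfM : ∀ x, |f x| ≤ M) :
    ∃ g : E → ℝ, (∀ x y, |g x - g y| ≤ L * ‖x - y‖) ∧ (∀ x, |g x| ≤ M) ∧ ∀ x : s, g x = f x := by
  classical
  set F : E → ℝ := fun x => if h : x ∈ s then f ⟨x, h⟩ else 0 with hF
  have hFs : ∀ x : s, F x = f x := fun x => by simp [hF]
  have hlip : LipschitzOnWith (Real.toNNReal L) F s := by
    refine LipschitzOnWith.of_dist_le_mul fun x hx y hy => ?_
    rw [Real.dist_eq, dist_eq_norm, Real.coe_toNNReal L hL, hFs ⟨x, hx⟩, hFs ⟨y, hy⟩]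
    exact hf _ _
  obtain ⟨g, hg, hgs⟩ := hlip.extend_real
  -- Clamping to `[-M, M]` is 1-Lipschitz and fixes the values on `s`.
  refine ⟨fun x => max (-M) (min M (g x)), fun x y => ?_, fun x => ?_, fun x => ?_⟩
  · have h1 := hg.dist_le_mul x y
    rw [Real.dist_eq, dist_eq_norm, Real.coe_toNNReal L hL] at h1
    refine le_trans (abs_max_sub_max_le_max _ _ _ _) ?_
    rw [sub_self, abs_zero, max_eq_right (abs_nonneg _)]
    refine le_trans (abs_min_sub_min_le_max _ _ _ _) ?_
    rwa [sub_self, abs_zero, max_eq_right (abs_nonneg _)]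
  · exact abs_le.2 ⟨le_max_left _ _, max_le (by linarith) (min_le_left _ _)⟩
  · dsimp only
    rw [← hgs x.2, hFs]
    have h := abs_le.1 (hfM x)
    rw [min_eq_right h.2, max_eq_right h.1]

theorem exists_paFun_approx {p K : ℕ} (hp : 1 ≤ p) (hK : 1 ≤ K)
    {𝒳 : Set (EuclideanSpace ℝ (Fin p))} {X L M μ : ℝ} (hX : 0 < X) (hL : 0 < L) (hM : 0 ≤ M)
    (h𝒳 : ∀ x ∈ 𝒳, ∀ j, |x j| ≤ X) {f : 𝒳 → ℝ}
    (hf : ∀ x y : 𝒳, |f x - f y| ≤ L * ‖(x : EuclideanSpace ℝ (Fin p)) - y‖)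
    (hfM : ∀ x, |f x| ≤ M)
    (hμ1 : 1 / 2 * L * (K : ℝ) ^ (1 / (p : ℝ)) ≤ μ)
    (hμ2 : 1 / 4 * p * L * X * (K : ℝ) ^ (1 / (p : ℝ)) + 1 / 2 * M ≤ μ) :
    ∃ θ : PAParam p K, ‖θ‖ ≤ μ ∧ ∀ x : 𝒳,
      |paFun θ x - f x| ≤ 2 * (√p + 3) * √p * L * X * (K : ℝ) ^ (-(1 / (p : ℝ))) := by
  have hp0 : (0 : ℝ) < p := by exact_mod_cast hp
  rw [Real.rpow_neg (Nat.cast_nonneg K)]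
  set κ : ℝ := (K : ℝ) ^ (1 / (p : ℝ)) with hκ
  have hκ1 : 1 ≤ κ := Real.one_le_rpow (by exact_mod_cast hK) (by positivity)
  have hκ0 : 0 < κ := by linarith
  set m : ℕ := ⌊κ⌋₊ with hm
  have hm1 : 1 ≤ m := Nat.le_floor (by simpa using hκ1)
  have hm1' : (1 : ℝ) ≤ m := by exact_mod_cast hm1
  have hmκ : (m : ℝ) ≤ κ := Nat.floor_le hκ0.le
  -- Rounding `κ` down to an integer costs at most a factor 2 in the mesh.
  have hκm : κ ≤ 2 * m := by
    have := (Nat.lt_floor_add_one κ).le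
    rw [← hm] at this
    linarith
  have hmK : m ^ p ≤ K := by
    have h1 : (m : ℝ) ^ p ≤ κ ^ p := by gcongr
    have h2 : κ ^ p = K := by
      rw [hκ, one_div]
      exact Real.rpow_inv_natCast_pow (Nat.cast_nonneg K) (by omega)
    rw [h2] at h1
    exact_mod_cast h1
  have hε : 0 ≤ X / m := by positivity
  obtain ⟨s, hs, hsX, hsε⟩ := (hasFiniteNet_real hm1 hX.le).pi hX.le hε p
  have hs0 : s.Nonempty := by
    obtain ⟨y, hy, -⟩ := hsε 0 (by simpa using hX.le)
    exact ⟨y, hy⟩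
  obtain ⟨c, hcs, hsc⟩ := s.exists_fin_enumeration hs0 (hs.trans hmK)
  -- The net fills the whole cube, so its centers may lie outside `𝒳`.
  obtain ⟨g, hg, hgM, hgf⟩ := exists_lipschitz_extension hL.le hM hf hfM
  -- This choice makes the curvature errors of order `L * X / κ`, like the Lipschitz one, and turns
  -- the parameter sizes into the two lower bounds on `μ`.
  set lam : ℝ := L * κ / (4 * X) with hlam
  have hlam0 : 0 < lam := by positivity
  obtain ⟨θ, hθ, happ⟩ := exists_paFun_approx_of_net hK (D := √p * (X / m)) (μ := μ) hL.le hlam0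
    hX.le hg hgM (fun k => WithLp.toLp 2 (c k))
    (fun k j => (norm_le_pi_norm (c k) j).trans (hsX _ (hcs k)))
    (by
      have : 2 * lam * X = 1 / 2 * L * κ := by rw [hlam]; field_simp; ring
      rwa [this])
    (by
      have : lam * (p * X ^ 2) + M / 2 = 1 / 4 * p * L * X * κ + 1 / 2 * M := by
        rw [hlam]; field_simp
      rwa [this])
  refine ⟨θ, hθ, fun x => ?_⟩
  rw [← hgf]
  refine (happ x ?_).trans ?_
  · have hx : ‖WithLp.ofLp (x : EuclideanSpace ℝ (Fin p))‖ ≤ X :=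
      (pi_norm_le_iff_of_nonneg hX.le).2 (h𝒳 x x.2)
    obtain ⟨y, hy, hxy⟩ := hsε _ hx
    obtain ⟨k, rfl⟩ := hsc y hy
    exact ⟨k, EuclideanSpace.norm_le_sqrt_card_mul hε fun j =>
      (norm_le_pi_norm (WithLp.ofLp (x : EuclideanSpace ℝ (Fin p)) - c k) j).trans hxy⟩
  · have hXm : X / m ≤ 2 * (X * κ⁻¹) := by
      rw [div_le_iff₀ (by linarith)]
      calc X = X * κ⁻¹ * κ := by field_simp
        _ ≤ X * κ⁻¹ * (2 * m) := by gcongr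
        _ = 2 * (X * κ⁻¹) * m := by ring
    have hsq : √(p : ℝ) ^ 2 = p := Real.sq_sqrt hp0.le
    have hs1 : 1 ≤ √(p : ℝ) := Real.one_le_sqrt.2 (by exact_mod_cast hp)
    set q : ℝ := √(p : ℝ)
    set U : ℝ := L * X * κ⁻¹ with hU
    have hU0 : 0 < U := by positivity
    have e1 : L / 2 * (q * (X / m)) ≤ q * U := by
      calc L / 2 * (q * (X / m)) ≤ L / 2 * (q * (2 * (X * κ⁻¹))) := by gcongr
        _ = q * U := by rw [hU]; ring
    have e2 : lam * (q * (X / m)) ^ 2 ≤ q ^ 2 * U := by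
      calc lam * (q * (X / m)) ^ 2 ≤ lam * (q * (2 * (X * κ⁻¹))) ^ 2 := by gcongr
        _ = q ^ 2 * U := by rw [hU, hlam]; field_simp; ring
    have e3 : (L / 2) ^ 2 / (4 * lam) = U / 4 := by
      rw [hU, hlam]; field_simp; ring
    have e4 : 2 * (q + 3) * q * L * X * κ⁻¹ = (2 * q ^ 2 + 6 * q) * U := by rw [hU]; ring
    rw [e3, e4]
    nlinarith [mul_nonneg hU0.le (sub_nonneg.2 hs1), mul_nonneg hU0.le (sq_nonneg q)]

/-! ### Vector-valued decision rules. -/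

section padr

variable {p : ℕ} {𝒳 : Set (EuclideanSpace ℝ (Fin p))} {d K : ℕ}

/-- The decision rule with parameter `θ`. -/
noncomputable def padrRule (𝒳 : Set (EuclideanSpace ℝ (Fin p))) (θ : Fin d → PAParam p K) :
    𝒳 → EuclideanSpace ℝ (Fin d) :=
  fun x => WithLp.toLp 2 fun i => paFun (θ i) x

theorem padrClass_eq_image {μ : ℝ} (hμ : 0 ≤ μ) :
    padrClass 𝒳 d K μ = padrRule (K := K) 𝒳 '' {θ | ‖θ‖ ≤ μ} := by
  ext f
  constructor
  · rintro ⟨θ, hθ, hf⟩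
    refine ⟨θ, (pi_norm_le_iff_of_nonneg hμ).2 hθ, ?_⟩
    ext x i
    exact (hf x i).symm
  · rintro ⟨θ, hθ, rfl⟩
    exact ⟨θ, (pi_norm_le_iff_of_nonneg hμ).1 hθ, fun x i => rfl⟩

theorem continuous_padrRule_param (hK : 1 ≤ K) (x : 𝒳) :
    Continuous fun θ : Fin d → PAParam p K => padrRule 𝒳 θ x := by
  refine (PiLp.continuous_toLp 2 _).comp (continuous_pi fun i => ?_)
  exact (continuous_paFun hK).comp (by fun_prop :
    Continuous fun θ : Fin d → PAParam p K => (θ i, (x : EuclideanSpace ℝ (Fin p))))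

theorem continuous_padrRule (hK : 1 ≤ K) (θ : Fin d → PAParam p K) :
    Continuous (padrRule 𝒳 θ) := by
  refine (PiLp.continuous_toLp 2 _).comp (continuous_pi fun i => ?_)
  exact (continuous_paFun hK).comp (by fun_prop :
    Continuous fun x : 𝒳 => (θ i, (x : EuclideanSpace ℝ (Fin p))))

theorem norm_padrRule_sub_le (hK : 1 ≤ K) {θ θ' : Fin d → PAParam p K} {r X : ℝ}
    (hX : 0 ≤ X) (hθ : ‖θ - θ'‖ ≤ r) (h𝒳 : ∀ x ∈ 𝒳, ∀ j, |x j| ≤ X) (x : 𝒳) :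
    ‖padrRule 𝒳 θ x - padrRule 𝒳 θ' x‖ ≤ √d * (2 * (p * X + 1) * r) := by
  have hr : 0 ≤ r := (norm_nonneg _).trans hθ
  exact EuclideanSpace.norm_le_sqrt_card_mul (by positivity) fun i =>
    abs_paFun_sub_le hK ((norm_le_pi_norm (θ - θ') i).trans hθ) (h𝒳 x x.2)

theorem norm_padrRule_le (hK : 1 ≤ K) {θ : Fin d → PAParam p K} {r X : ℝ}
    (hX : 0 ≤ X) (hθ : ‖θ‖ ≤ r) (h𝒳 : ∀ x ∈ 𝒳, ∀ j, |x j| ≤ X) (x : 𝒳) :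
    ‖padrRule 𝒳 θ x‖ ≤ √d * (2 * (p * X + 1) * r) := by
  have hr : 0 ≤ r := (norm_nonneg _).trans hθ
  exact EuclideanSpace.norm_le_sqrt_card_mul (by positivity) fun i =>
    abs_paFun_le hK ((norm_le_pi_norm θ i).trans hθ) (h𝒳 x x.2)

/-- The empirical risk is continuous on a compact ball of parameters. -/
theorem ermSolutions_padrClass_nonempty {𝒴 : Type*} {n : ℕ} (hK : 1 ≤ K)
    {μ : ℝ} (hμ : 0 ≤ μ) {φ : EuclideanSpace ℝ (Fin d) → 𝒴 → ℝ}
    (hφ : ∀ y, Continuous fun z => φ z y) (S : Fin n → 𝒳 × 𝒴) :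
    (ermSolutions φ S (padrClass 𝒳 d K μ)).Nonempty := by
  have hc : Continuous fun θ : Fin d → PAParam p K => empRisk φ S (padrRule 𝒳 θ) := by
    unfold empRisk
    exact continuous_const.mul (continuous_finsetSum _ fun s _ =>
      (hφ (S s).2).comp (continuous_padrRule_param hK (S s).1))
  obtain ⟨θ, hθ, hmin⟩ := (isCompact_closedBall (0 : Fin d → PAParam p K) μ).exists_isMinOn
    ⟨0, by simpa using hμ⟩ hc.continuousOn
  rw [padrClass_eq_image hμ]
  refine ⟨padrRule 𝒳 θ, ⟨θ, by simpa using hθ, rfl⟩, ?_⟩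
  rintro _ ⟨θ', hθ', rfl⟩
  exact hmin (by simpa using hθ')

theorem exists_padrRule_approx (hp : 1 ≤ p) (hK : 1 ≤ K) {X L M μ : ℝ} (hX : 0 < X) (hL : 0 < L)
    (hM : 0 ≤ M) (h𝒳 : ∀ x ∈ 𝒳, ∀ j, |x j| ≤ X) {f : 𝒳 → EuclideanSpace ℝ (Fin d)}
    (hf : f ∈ lipClass 𝒳 d L M)
    (hμ1 : 1 / 2 * L * (K : ℝ) ^ (1 / (p : ℝ)) ≤ μ)
    (hμ2 : 1 / 4 * p * L * X * (K : ℝ) ^ (1 / (p : ℝ)) + 1 / 2 * M ≤ μ) :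
    ∃ θ : Fin d → PAParam p K, ‖θ‖ ≤ μ ∧ ∀ x, ‖padrRule 𝒳 θ x - f x‖ ≤
      √d * (2 * (√p + 3) * √p * L * X * (K : ℝ) ^ (-(1 / (p : ℝ)))) := by
  have hμ : 0 ≤ μ := le_trans (by positivity) hμ1
  choose θ hθ happ using fun i => exists_paFun_approx hp hK hX hL hM h𝒳 (f := fun x => f x i)
    (fun x y => (PiLp.norm_apply_le (f x - f y) i).trans (hf.2 x y)) (fun x => hf.1 x i) hμ1 hμ2
  exact ⟨θ, (pi_norm_le_iff_of_nonneg hμ).2 hθ, fun x =>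
    EuclideanSpace.norm_le_sqrt_card_mul (by positivity) fun i => happ i x⟩

end padr

/-! ### Expectations and concentration of sample means. -/

theorem extExpectation_eq_integral {Ω : Type*} [MeasurableSpace Ω] {P : Measure Ω} {g : Ω → ℝ}
    (hg : Integrable g P) : extExpectation P g = ((∫ ω, g ω ∂P : ℝ) : EReal) := by
  have hneg : ∫⁻ ω, ENNReal.ofReal (-g ω) ∂P ≠ ⊤ := hg.neg.lintegral_lt_top.ne
  rw [extExpectation, if_neg hg.lintegral_lt_top.ne,
    integral_eq_lintegral_pos_part_sub_lintegral_neg_part hg, EReal.coe_sub,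
    EReal.coe_ennreal_toReal hg.lintegral_lt_top.ne,
    EReal.coe_ennreal_toReal hneg]

section deviation

variable {β Ω : Type*} [MeasurableSpace β] {P : Measure β} [MeasurableSpace Ω] {Pr : Measure Ω}
  [IsProbabilityMeasure Pr] {n : ℕ} {S : Fin n → Ω → β}

/-- Hoeffding's inequality for the sample mean of a bounded function. -/
theorem measureReal_sampleMean_deviation_le (hn : 1 ≤ n) (hS_law : ∀ s, HasLaw (S s) P Pr)
    (hS_indep : iIndepFun S Pr) {g : β → ℝ} (hg : Measurable g) {M : ℝ} (hM : 0 < M)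
    (hgM : ∀ b, |g b| ≤ M) {t : ℝ} (ht : 0 ≤ t) :
    Pr.real {ω | (1 / (n : ℝ)) * ∑ s, g (S s ω) + t ≤ ∫ b, g b ∂P} ≤
      Real.exp (-(n * t ^ 2 / (2 * M ^ 2))) := by
  have hn0 : (0 : ℝ) < n := by exact_mod_cast hn
  have hsub : ∀ s, HasSubgaussianMGF (fun ω => (∫ b, g b ∂P) - g (S s ω))
      ((‖M - -M‖₊ / 2) ^ 2) Pr := by
    intro s
    have h := hasSubgaussianMGF_of_mem_Icc (X := g ∘ S s) (μ := Pr) (a := -M) (b := M)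
      (hg.comp_aemeasurable (hS_law s).aemeasurable)
      (Filter.Eventually.of_forall fun ω => abs_le.1 (hgM (S s ω)))
    have h2 := h.neg
    rw [(hS_law s).integral_comp hg.aestronglyMeasurable] at h2
    convert h2 using 1
    ext ω
    simp
  have hind : iIndepFun (fun s ω => (∫ b, g b ∂P) - g (S s ω)) Pr :=
    hS_indep.comp (fun _ b => (∫ b, g b ∂P) - g b) fun _ => hg.const_sub _
  -- The `n` summands have variance proxy `M ^ 2` each, so the threshold `n * t` gives exponent `(n
  -- t)² / (2 n M²)`.
  have key := HasSubgaussianMGF.measure_sum_ge_le_of_iIndepFun hind (s := Finset.univ)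
    (fun s _ => hsub s) (ε := n * t) (by positivity)
  convert key using 2
  · ext ω
    simp only [Set.mem_ofPred_eq, Finset.sum_sub_distrib, Finset.sum_const, Finset.card_univ,
      Fintype.card_fin, nsmul_eq_mul]
    rw [← mul_le_mul_iff_right₀ hn0, mul_add, ← mul_assoc, mul_one_div_cancel hn0.ne', one_mul]
    constructor <;> intro h <;> linarith
  · have hc : ((‖M - -M‖₊ / 2) ^ 2 : NNReal) = (M ^ 2 : ℝ) := by
      push_cast
      rw [Real.norm_of_nonneg (by linarith)]
      ring
    simp only [Finset.sum_const, Finset.card_univ, Fintype.card_fin, nsmul_eq_mul]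
    push_cast at hc ⊢
    rw [hc]
    field_simp

/-- With probability at least `1 - δ`, the sample means of finitely many bounded functions are not
much smaller than their expectations, and that of one more function is not much larger. -/
theorem exists_event_deviation (hn : 1 ≤ n) (hS_law : ∀ s, HasLaw (S s) P Pr)
    (hS_indep : iIndepFun S Pr) {ι : Type*} (G : Finset ι) {N : ℕ} (hN : 1 ≤ N) (hG : G.card ≤ N)
    {g : ι → β → ℝ} (hg : ∀ i ∈ G, Measurable (g i)) {M : ℝ} (hM : 0 < M)
    (hgM : ∀ i ∈ G, ∀ b, |g i b| ≤ M) {h : β → ℝ} (hh : Measurable h) (hhM : ∀ b, |h b| ≤ M)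
    {δ : ℝ} (hδ : 0 < δ) (hδ1 : δ ≤ 1) :
    ∃ E : Set Ω, MeasurableSet E ∧ ENNReal.ofReal (1 - δ) ≤ Pr E ∧ ∀ ω ∈ E,
      (∀ i ∈ G, ∫ b, g i b ∂P ≤ (1 / (n : ℝ)) * ∑ s, g i (S s ω) +
        M * √(2 * (Real.log N + Real.log (2 / δ)) / n)) ∧
      (1 / (n : ℝ)) * ∑ s, h (S s ω) ≤ ∫ b, h b ∂P + M * √(2 * Real.log (2 / δ) / n) := by
  have hn0 : (0 : ℝ) < n := by exact_mod_cast hn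
  have hN0 : (0 : ℝ) < N := by exact_mod_cast hN
  have hl : 0 ≤ Real.log (2 / δ) := Real.log_nonneg (by rw [le_div_iff₀ hδ]; linarith)
  have hlN : 0 ≤ Real.log N := Real.log_natCast_nonneg N
  have hexp : Real.exp (-Real.log (2 / δ)) = δ / 2 := by
    rw [Real.exp_neg, Real.exp_log (by positivity), inv_div]
  -- Deviation `M * √(2 * a / n)` has Hoeffding exponent `a`: the choices below give probability `δ
  -- / (2 * N)` per net point and `δ / 2` for `h`.
  have exponent : ∀ a : ℝ, 0 ≤ a → n * (M * √(2 * a / n)) ^ 2 / (2 * M ^ 2) = a := by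
    intro a ha
    rw [mul_pow, Real.sq_sqrt (by positivity)]
    field_simp
  set t := M * √(2 * (Real.log N + Real.log (2 / δ)) / n) with ht
  set t' := M * √(2 * Real.log (2 / δ) / n) with ht'
  set A : ι → Set Ω := fun i => {ω | (1 / (n : ℝ)) * ∑ s, g i (S s ω) + t ≤ ∫ b, g i b ∂P} with hA
  set B : Set Ω := {ω | (1 / (n : ℝ)) * ∑ s, -h (S s ω) + t' ≤ ∫ b, -h b ∂P} with hB
  have hAm : ∀ i ∈ G, Pr.real (A i) ≤ δ / (2 * N) := by
    intro i hi
    refine (measureReal_sampleMean_deviation_le hn hS_law hS_indep (hg i hi) hM (hgM i hi)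
      (by positivity)).trans_eq ?_
    rw [exponent _ (by positivity), neg_add, Real.exp_add, hexp, Real.exp_neg, Real.exp_log hN0]
    field_simp
  have hBm : Pr.real B ≤ δ / 2 := by
    refine (measureReal_sampleMean_deviation_le hn hS_law hS_indep hh.neg hM
      (fun b => by simpa using hhM b) (t := t') (by positivity)).trans_eq ?_
    rw [exponent _ hl, hexp]
  set bad : Set Ω := (⋃ i ∈ G, A i) ∪ B with hbad
  have hbadm : Pr.real bad ≤ δ := by
    calc Pr.real bad ≤ Pr.real (⋃ i ∈ G, A i) + Pr.real B := measureReal_union_le _ _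
      _ ≤ ∑ i ∈ G, Pr.real (A i) + δ / 2 := by
          gcongr
          exact measureReal_biUnion_finset_le G A
      _ ≤ ∑ _i ∈ G, δ / (2 * N) + δ / 2 := by
          gcongr with i hi
          exact hAm i hi
      _ = G.card * (δ / (2 * N)) + δ / 2 := by rw [Finset.sum_const, nsmul_eq_mul]
      _ ≤ N * (δ / (2 * N)) + δ / 2 := by gcongr
      _ = δ := by field_simp; ring
  -- The sample is only a.e. measurable, so `bad` is replaced by a measurable hull.
  refine ⟨(toMeasurable Pr bad)ᶜ, (measurableSet_toMeasurable _ _).compl, ?_, fun ω hω => ?_⟩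
  · rw [prob_compl_eq_one_sub (measurableSet_toMeasurable _ _), measure_toMeasurable,
      ENNReal.ofReal_sub _ hδ.le, ENNReal.ofReal_one]
    gcongr
    rw [← ofReal_measureReal]
    exact ENNReal.ofReal_le_ofReal hbadm
  · have hω' : ω ∉ bad := fun hb => hω (subset_toMeasurable _ _ hb)
    rw [hbad, Set.mem_union, not_or] at hω'
    constructor
    · intro i hi
      by_contra hlt
      exact hω'.1 (Set.mem_biUnion hi (not_le.1 hlt).le)
    · by_contra hlt
      refine hω'.2 ?_
      simp only [hB, Set.mem_ofPred_eq, Finset.sum_neg_distrib, integral_neg]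
      linarith [not_le.1 hlt]

end deviation

/-! ### Transfer between nearby rules, and numerical estimates. -/

theorem integral_le_add_of_abs_sub_le {β : Type*} [MeasurableSpace β] {P : Measure β}
    [IsProbabilityMeasure P] {g h : β → ℝ} (hg : Integrable g P) (hh : Integrable h P) {ε : ℝ}
    (hgh : ∀ b, |g b - h b| ≤ ε) : ∫ b, g b ∂P ≤ ∫ b, h b ∂P + ε := by
  calc ∫ b, g b ∂P ≤ ∫ b, (h b + ε) ∂P :=
        integral_mono hg (hh.add (integrable_const _)) fun b => by
          linarith [(abs_le.1 (hgh b)).2]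
    _ = ∫ b, h b ∂P + ε := by rw [integral_add hh (integrable_const _)]; simp

theorem empRisk_le_add_of_abs_sub_le {𝒳 𝒴 Z : Type*} {n : ℕ} (hn : 1 ≤ n)
    {φ : Z → 𝒴 → ℝ} (S : Fin n → 𝒳 × 𝒴) {f g : 𝒳 → Z} {ε : ℝ}
    (hfg : ∀ x y, |φ (f x) y - φ (g x) y| ≤ ε) : empRisk φ S f ≤ empRisk φ S g + ε := by
  have hn0 : (0 : ℝ) < n := by exact_mod_cast hn
  have h : ∑ s, φ (f (S s).1) (S s).2 ≤ ∑ s, (φ (g (S s).1) (S s).2 + ε) :=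
    Finset.sum_le_sum fun s _ => by linarith [(abs_le.1 (hfg (S s).1 (S s).2)).2]
  rw [Finset.sum_add_distrib, Finset.sum_const, Finset.card_univ, Fintype.card_fin,
    nsmul_eq_mul] at h
  unfold empRisk
  calc (1 / (n : ℝ)) * ∑ s, φ (f (S s).1) (S s).2
      ≤ (1 / (n : ℝ)) * (∑ s, φ (g (S s).1) (S s).2 + n * ε) := by gcongr
    _ = _ := by field_simp

/-- Cauchy–Schwarz for the vectors `(X, …, X, 1)` and `(1, …, 1)` with `p + 1` entries. -/
theorem discretization_term_le {d K p : ℕ} (hK : 1 ≤ K) (X : ℝ) :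
    √(d : ℝ) * (p * X + 1) ≤ √(2 * d * K * (p + 1) * (p * X ^ 2 + 1)) := by
  have hK' : (1 : ℝ) ≤ K := by exact_mod_cast hK
  refine Real.le_sqrt_of_sq_le ?_
  rw [mul_pow, Real.sq_sqrt (Nat.cast_nonneg d)]
  have h1 : (p * X + 1) ^ 2 ≤ ((p : ℝ) + 1) * (p * X ^ 2 + 1) := by
    nlinarith [mul_nonneg (Nat.cast_nonneg (α := ℝ) p) (sq_nonneg (X - 1))]
  have h2 : 0 ≤ ((p : ℝ) + 1) * (p * X ^ 2 + 1) := by positivity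
  calc (d : ℝ) * (p * X + 1) ^ 2 ≤ d * (((p : ℝ) + 1) * (p * X ^ 2 + 1)) := by gcongr
    _ = d * 1 * (((p : ℝ) + 1) * (p * X ^ 2 + 1)) := by ring
    _ ≤ d * (2 * K) * (((p : ℝ) + 1) * (p * X ^ 2 + 1)) := by gcongr; linarith
    _ = _ := by ring

theorem deviation_term_le {q n : ℕ} {l : ℝ} (hl : 0 ≤ l) :
    √(2 * (Real.log (n ^ q : ℕ) + l) / n) ≤ 4 * √(q * Real.log n / n) + √2 * √(l / n) := by
  have hlog : 0 ≤ Real.log n := Real.log_natCast_nonneg n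
  have h2 : √(2 : ℝ) ≤ 4 := Real.sqrt_le_iff.2 ⟨by norm_num, by norm_num⟩
  have e : 2 * (Real.log (n ^ q : ℕ) + l) / n = 2 * (q * Real.log n / n + l / n) := by
    rw [Nat.cast_pow, Real.log_pow]; ring
  calc √(2 * (Real.log (n ^ q : ℕ) + l) / n)
      = √2 * √(q * Real.log n / n + l / n) := by rw [e, Real.sqrt_mul zero_le_two]
    _ ≤ √2 * (√(q * Real.log n / n) + √(l / n)) := by
        gcongr
        refine Real.sqrt_le_iff.2 ⟨by positivity, ?_⟩
        rw [add_sq, Real.sq_sqrt (by positivity), Real.sq_sqrt (by positivity)]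
        have : 0 ≤ 2 * √(q * Real.log n / n) * √(l / n) := by positivity
        linarith
    _ ≤ 4 * √(q * Real.log n / n) + √2 * √(l / n) := by
        rw [mul_add]
        gcongr

/-! ### The excess risk bound. -/

theorem theorem1
    {p d n K : ℕ} (hn : 1 ≤ n) (hK : 1 ≤ K)
    -- the compact feature support, and the largest sup-norm of a feature
    (𝒳 : Set (EuclideanSpace ℝ (Fin p))) (h𝒳 : IsCompact 𝒳)
    (Xbar : ℝ) (hXbar_pos : 0 < Xbar)
    (hXbar : IsGreatest ((fun x : EuclideanSpace ℝ (Fin p) => ‖WithLp.ofLp x‖) '' 𝒳) Xbar)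
    -- the joint law of `(X, Y)`
    {𝒴 : Type*} [MeasurableSpace 𝒴] (P : Measure (𝒳 × 𝒴)) [IsProbabilityMeasure P]
    -- an i.i.d. sample
    {Ω : Type*} [MeasurableSpace Ω] (Pr : Measure Ω) [IsProbabilityMeasure Pr]
    (S : Fin n → Ω → 𝒳 × 𝒴) (hS_law : ∀ s, HasLaw (S s) P Pr) (hS_indep : iIndepFun S Pr)
    -- the cost function
    (φ : EuclideanSpace ℝ (Fin d) → 𝒴 → ℝ) (hφ_meas : ∀ z, Measurable (φ z))
    (Lφ Cφ : ℝ) (hLφ : 0 < Lφ) (hCφ : 0 < Cφ) (z₀ : EuclideanSpace ℝ (Fin d))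
    (hφ_lip : ∀ y z z', |φ z y - φ z' y| ≤ Lφ * ‖z - z'‖)
    (hφ_bdd : ∀ y, |φ z₀ y| ≤ Cφ)
    -- the optimal decision rule
    (fstar : 𝒳 → EuclideanSpace ℝ (Fin d))
    (hopt : ∀ g : 𝒳 → EuclideanSpace ℝ (Fin d), Measurable g → risk P φ fstar ≤ risk P φ g)
    (Lz Mz : ℝ) (hLz : 0 < Lz) (hMz : 0 < Mz) (hfstar : fstar ∈ lipClass 𝒳 d Lz Mz)
    -- the size of the parameters
    (μ : ℝ)
    (hμ : max (1 / 2 * Lz * (K : ℝ) ^ (1 / (p : ℝ)))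
      (1 / 4 * p * Lz * Xbar * (K : ℝ) ^ (1 / (p : ℝ)) + 1 / 2 * Mz) ≤ μ)
    (Mμ : ℝ) (hMμ : Mμ = Cφ + Lφ * (2 * √d * μ * (p * Xbar + 1) + ‖z₀‖))
    (δ : ℝ) (hδ : 0 < δ) :
    (∀ ω, (ermSolutions φ (fun s => S s ω) (padrClass 𝒳 d K μ)).Nonempty) ∧
    ∃ E : Set Ω, MeasurableSet E ∧ ENNReal.ofReal (1 - δ) ≤ Pr E ∧
      ∀ ω ∈ E, ∀ f ∈ ermSolutions φ (fun s => S s ω) (padrClass 𝒳 d K μ),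
        risk P φ f ≤
          (⨅ (g : 𝒳 → EuclideanSpace ℝ (Fin d)) (_ : Measurable g), risk P φ g) +
          ((2 * √d * (√p + 3) * √p * Lφ * Lz * Xbar * (K : ℝ) ^ (-(1 / (p : ℝ)))
            + 16 * μ * Lφ * √(2 * d * K * (p + 1) * (p * Xbar ^ 2 + 1)) / n
            + 4 * Mμ * √(2 * d * K * (p + 1) * Real.log n / n)
            + 2 * √2 * Mμ * √(Real.log (2 / δ) / n) : ℝ) : EReal) := by
  -- For `p = 0` every feature has norm `0`, contradicting `Xbar > 0`.
  rcases Nat.eq_zero_or_pos p with rfl | hp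
  · obtain ⟨x, -, hx⟩ := hXbar.1
    have : WithLp.ofLp x = 0 := Subsingleton.elim _ _
    change ‖WithLp.ofLp x‖ = Xbar at hx
    rw [this, norm_zero] at hx
    linarith
  obtain ⟨hμ1, hμ2⟩ := max_le_iff.1 hμ
  have hμ0 : 0 ≤ μ := le_trans (by positivity) hμ1
  have hφ_cont : ∀ y, Continuous fun z => φ z y := fun y =>
    (LipschitzWith.of_dist_le_mul (K := Real.toNNReal Lφ) fun z z' => by
      rw [Real.dist_eq, dist_eq_norm, Real.coe_toNNReal Lφ hLφ.le]
      exact hφ_lip y z z').continuous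
  refine ⟨fun ω => ermSolutions_padrClass_nonempty hK hμ0 hφ_cont _, ?_⟩
  -- For `δ > 1` the empty event is admissible.
  rcases lt_or_ge 1 δ with hδ1 | hδ1
  · exact ⟨∅, MeasurableSet.empty, by simp [hδ1.le], by simp⟩
  have hX𝒳 : ∀ x ∈ 𝒳, ∀ j, |x j| ≤ Xbar := fun x hx j =>
    (norm_le_pi_norm (WithLp.ofLp x) j).trans (hXbar.2 ⟨x, hx, rfl⟩)
  have hMμ0 : 0 < Mμ := by rw [hMμ]; positivity
  -- losses of continuous bounded decision rules
  have loss_meas : ∀ {f : 𝒳 → EuclideanSpace ℝ (Fin d)}, Continuous f →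
      Measurable fun q : 𝒳 × 𝒴 => φ (f q.1) q.2 := fun {f} hf =>
    (measurable_uncurry_of_continuous_of_measurable (u := fun z y => φ z y) hφ_cont hφ_meas).comp
      ((hf.measurable.comp measurable_fst).prodMk measurable_snd)
  have loss_bdd : ∀ {z : EuclideanSpace ℝ (Fin d)} {B : ℝ} (y : 𝒴), ‖z‖ ≤ B →
      |φ z y| ≤ Cφ + Lφ * (B + ‖z₀‖) := by
    intro z B y hz
    have h1 := hφ_lip y z z₀
    have h2 : Lφ * ‖z - z₀‖ ≤ Lφ * (B + ‖z₀‖) := by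
      gcongr
      exact (norm_sub_le _ _).trans (by gcongr)
    have h3 := abs_sub_abs_le_abs_sub (φ z y) (φ z₀ y)
    linarith [hφ_bdd y]
  have loss_int : ∀ {f : 𝒳 → EuclideanSpace ℝ (Fin d)} {B : ℝ}, Continuous f →
      (∀ x, ‖f x‖ ≤ B) → Integrable (fun q : 𝒳 × 𝒴 => φ (f q.1) q.2) P := fun hf hB =>
    Integrable.of_bound (loss_meas hf).aestronglyMeasurable _
      (Filter.Eventually.of_forall fun q => loss_bdd q.2 (hB q.1))
  have rule_norm : ∀ {θ : Fin d → PAParam p K}, ‖θ‖ ≤ μ → ∀ x,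
      ‖padrRule 𝒳 θ x‖ ≤ √d * (2 * (p * Xbar + 1) * μ) := fun hθ =>
    norm_padrRule_le hK hXbar_pos.le hθ hX𝒳
  have rule_int : ∀ {θ : Fin d → PAParam p K}, ‖θ‖ ≤ μ →
      Integrable (fun q : 𝒳 × 𝒴 => φ (padrRule 𝒳 θ q.1) q.2) P := fun {θ} hθ =>
    loss_int (continuous_padrRule hK θ) (rule_norm hθ)
  have rule_bdd : ∀ {θ : Fin d → PAParam p K}, ‖θ‖ ≤ μ → ∀ q : 𝒳 × 𝒴,
      |φ (padrRule 𝒳 θ q.1) q.2| ≤ Mμ := by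
    intro θ hθ q
    refine (loss_bdd q.2 (rule_norm hθ q.1)).trans_eq ?_
    rw [hMμ]; ring
  -- the optimal rule and its approximation in the class
  have hfstar_cont : Continuous fstar :=
    (LipschitzWith.of_dist_le_mul (K := Real.toNNReal Lz) fun x x' => by
      rw [dist_eq_norm, Subtype.dist_eq, dist_eq_norm, Real.coe_toNNReal Lz hLz.le]
      exact hfstar.2 x x').continuous
  have hfstar_int : Integrable (fun q : 𝒳 × 𝒴 => φ (fstar q.1) q.2) P :=
    loss_int hfstar_cont fun x => EuclideanSpace.norm_le_sqrt_card_mul hMz.le (hfstar.1 x)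
  obtain ⟨θ₀, hθ₀, happ⟩ := exists_padrRule_approx hp hK hXbar_pos hLz hMz.le hX𝒳 hfstar hμ1 hμ2
  have approx_risk := integral_le_add_of_abs_sub_le (rule_int hθ₀) hfstar_int
    (ε := Lφ * (√d * (2 * (√p + 3) * √p * Lz * Xbar * (K : ℝ) ^ (-(1 / (p : ℝ))))))
    fun q => (hφ_lip q.2 _ _).trans (by gcongr; exact happ q.1)
  -- the deviation event for a finite net of parameters
  obtain ⟨G, hG, hGμ, hGnet⟩ := hasFiniteNet_paParam hn hμ0 d p K
  obtain ⟨E, hE, hPrE, hdev⟩ := exists_event_deviation hn hS_law hS_indep G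
    (Nat.one_le_pow _ _ hn) hG (g := fun θ q => φ (padrRule 𝒳 θ q.1) q.2)
    (fun θ _ => loss_meas (continuous_padrRule hK θ)) hMμ0 (fun θ hθ => rule_bdd (hGμ θ hθ))
    (loss_meas (continuous_padrRule hK θ₀)) (rule_bdd hθ₀) hδ hδ1
  refine ⟨E, hE, hPrE, fun ω hω f hf => ?_⟩
  obtain ⟨hdevG, hdev₀⟩ := hdev ω hω
  rw [padrClass_eq_image hμ0] at hf
  obtain ⟨⟨θ, hθ, rfl⟩, hmin⟩ := hf
  -- The minimizer `θ` depends on the sample, hence the detour through `G`. The risk of `θ` is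
  -- bounded via risk of `θ'`, empirical risks of `θ'`, `θ`, `θ₀`, then risks of `θ₀` and `fstar`.
  obtain ⟨θ', hθ'G, hθθ'⟩ := hGnet θ hθ
  have hclose : ∀ x y, |φ (padrRule 𝒳 θ x) y - φ (padrRule 𝒳 θ' x) y| ≤
      Lφ * (√d * (2 * (p * Xbar + 1) * (μ / n))) := fun x y =>
    (hφ_lip y _ _).trans (by
      gcongr
      exact norm_padrRule_sub_le hK hXbar_pos.le hθθ' hX𝒳 x)
  have h1 := integral_le_add_of_abs_sub_le (rule_int hθ) (rule_int (hGμ θ' hθ'G))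
    fun q => hclose q.1 q.2
  have h2 := hdevG θ' hθ'G
  have h3 := empRisk_le_add_of_abs_sub_le hn (fun s => S s ω) (f := padrRule 𝒳 θ')
    (g := padrRule 𝒳 θ) fun x y => (abs_sub_comm _ _).trans_le (hclose x y)
  have h4 := hmin _ ⟨θ₀, hθ₀, rfl⟩
  unfold empRisk at h3 h4
  have hinf : risk P φ fstar ≤
      ⨅ (g : 𝒳 → EuclideanSpace ℝ (Fin d)) (_ : Measurable g), risk P φ g :=
    le_iInf₂ hopt
  refine le_trans ?_ (add_le_add_left hinf _)
  have hθ_risk : risk P φ (padrRule 𝒳 θ) = _ := extExpectation_eq_integral (rule_int hθ)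
  have hfstar_risk : risk P φ fstar = _ := extExpectation_eq_integral hfstar_int
  rw [hθ_risk, hfstar_risk, ← EReal.coe_add, EReal.coe_le_coe_iff]
  have hl : 0 ≤ Real.log (2 / δ) := Real.log_nonneg (by rw [le_div_iff₀ hδ]; linarith)
  -- The deviations over `G` and at `θ₀` each contribute one `√2`, giving `2 * √2`. The two passages
  -- between `θ` and `θ'` cost `4` of the allowed `16`.
  have t1 := mul_le_mul_of_nonneg_left
    (deviation_term_le (q := 2 * d * K * (p + 1)) (n := n) hl) hMμ0.le
  have t2 : √(2 * Real.log (2 / δ) / n) = √2 * √(Real.log (2 / δ) / n) := by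
    rw [mul_div_assoc, Real.sqrt_mul zero_le_two]
  have hc : 0 ≤ μ * Lφ / n := by positivity
  have t3 := mul_le_mul_of_nonneg_left (discretization_term_le (d := d) (p := p) hK Xbar) hc
  set W := √(2 * d * K * (p + 1) * (p * Xbar ^ 2 + 1))
  have hW : 0 ≤ μ * Lφ / n * W := mul_nonneg hc (Real.sqrt_nonneg _)
  have t4 : Lφ * (√d * (2 * (p * Xbar + 1) * (μ / n))) =
      2 * (μ * Lφ / n * (√d * (p * Xbar + 1))) := by ring
  have t5 : 16 * μ * Lφ * W / n = 16 * (μ * Lφ / n * W) := by ring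
  rw [t2] at hdev₀
  rw [t4] at h1 h3
  rw [t5]
  push_cast at t1 h2
  linarith
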